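/- Let $\mathcal P$ be a Poisson process on $(0,\infty)$ with constant intensity $\tfrac12$, with points $0<T_1<T_2<\cdots$. Put $N(V)=2\,\#\{j: T_j\le V\}$ and $R(V)=N(V)-V$ for $V\ge 0$. For every $c\in(\tfrac14,\tfrac12)$ the improper integral $$\int_0^\infty V^{-2c}\,dR(V)=\lim_{A\to0+,\,B\to\infty}\Big(2\sum_{A<T_j\le B}T_j^{-2c}-\int_A^B V^{-2c}\,dV\Big)$$ converges almost surely. Fix an integer $m\ge1$ and let $c_j=\tfrac14+\eta_j$ with $\eta_j\in(0,\tfrac14)$ for $1\le j\le m$. If $(\eta_1,\dots,\eta_m)$ tends to the zero vector in $\mathbb R^m$ in such a way that $\eta_j/\eta_{j+1}\to0$ for each $1\le j\le m-1$, then the $m$-dimensional random vector $$\Big(\big(2c_1-\tfrac12\big)^{1/2}\int_0^\infty V^{-2c_1}\,dR(V),\ \dots,\ \big(2c_m-\tfrac12\big)^{1/2}\int_0^\infty V^{-2c_m}\,dR(V)\Big)$$ converges in distribution to the distribution of $m$ independent $N(0,1)$ variables. -/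

import Mathlib

open MeasureTheory ProbabilityTheory Filter Topology
open scoped NNReal ENNReal

noncomputable section

/-- The number of terms of the sequence `x` in `(-∞, V]`.  For a sequence of positive points this is
the number of points in `(0, V]`. -/
def countingFunction (x : ℕ → ℝ) (V : ℝ) : ℕ := {j | x j ≤ V}.ncard

/-- A random sequence `T ω 0, T ω 1, …` is the increasing enumeration of the points of a Poisson
process on the positive real line with constant intensity `r`: almost surely the points are
positive, strictly increasing and locally finite; the counting process has independent increments;
and the number of points in `(s, t]` is Poisson distributed with mean `r * (t - s)`. -/
structure IsPoissonProcess {Ω : Type*} [MeasurableSpace Ω] (T : Ω → ℕ → ℝ) (r : ℝ≥0)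
    (P : Measure Ω) : Prop where
  measurable : Measurable T
  pos : ∀ᵐ ω ∂P, ∀ j, 0 < T ω j
  strictMono : ∀ᵐ ω ∂P, StrictMono (T ω)
  tendsto_atTop : ∀ᵐ ω ∂P, Tendsto (T ω) atTop atTop
  indep : HasIndepIncrements (fun (t : ℝ≥0) ω ↦ countingFunction (T ω) t) P
  law : ∀ s t : ℝ≥0, s ≤ t →
    HasLaw (fun ω ↦ countingFunction (T ω) t - countingFunction (T ω) s)
      (poissonMeasure (r * (t - s))) P

/-- `N(V)`: twice the number of points in `(0, V]`. -/
def NFun (x : ℕ → ℝ) (V : ℝ) : ℝ := 2 * countingFunction x V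

/-- `R(V) = N(V) - V`. -/
def RFun (x : ℕ → ℝ) (V : ℝ) : ℝ := NFun x V - V

/-- The measure `dN`: a point mass of weight `2` at each point of the sequence. -/
def dN (x : ℕ → ℝ) : Measure ℝ := Measure.sum fun j ↦ (2 : ℝ≥0∞) • Measure.dirac (x j)

/-- `∫_A^B f(V) dR(V)`, the integral over `(A, B]` against `dR = dN - dV`. -/
def integralDR (x : ℕ → ℝ) (f : ℝ → ℝ) (A B : ℝ) : ℝ :=
  (∫ V in Set.Ioc A B, f V ∂(dN x)) - ∫ V in A..B, f V

/-- The improper integral `∫_0^∞ f(V) dR(V)` converges to `h`: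
`∫_A^B f(V) dR(V) → h` as `A → 0+` and `B → ∞`. -/
def HasImproperIntegralDR (x : ℕ → ℝ) (f : ℝ → ℝ) (h : ℝ) : Prop :=
  Tendsto (fun p : ℝ × ℝ ↦ integralDR x f p.1 p.2) (𝓝[>] 0 ×ˢ atTop) (𝓝 h)

open Classical in
/-- The value of the improper integral `∫_0^∞ f(V) dR(V)`, and `0` if it diverges. -/
def improperIntegralDR (x : ℕ → ℝ) (f : ℝ → ℝ) : ℝ :=
  if h : ∃ a, HasImproperIntegralDR x f a then h.choose else 0

/-- `H(c) = ∫_0^∞ V^(-2c) dR(V)`. -/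
def HVar (x : ℕ → ℝ) (c : ℝ) : ℝ := improperIntegralDR x fun V ↦ V ^ (-2 * c)

/-- `dN` is the Lebesgue–Stieltjes measure of `N`. -/
theorem dN_Ioc (x : ℕ → ℝ) {A B : ℝ} (hAB : A ≤ B) (hfin : {j | x j ≤ B}.Finite) :
    dN x (Set.Ioc A B) = ENNReal.ofReal (NFun x B - NFun x A) := by
  have hA : {j | x j ≤ A} ⊆ {j | x j ≤ B} := fun j (hj : x j ≤ A) ↦ hj.trans hAB
  have hset : {j | x j ∈ Set.Ioc A B} = {j | x j ≤ B} \ {j | x j ≤ A} := by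
    ext j; simp [and_comm]
  have h1 : dN x (Set.Ioc A B) = ∑' j, {j | x j ∈ Set.Ioc A B}.indicator (fun _ ↦ (2 : ℝ≥0∞)) j := by
    rw [dN, Measure.sum_apply _ measurableSet_Ioc]
    refine tsum_congr fun j ↦ ?_
    by_cases h : x j ∈ Set.Ioc A B
    · rw [Set.indicator_of_mem (by exact h), Measure.smul_apply,
        Measure.dirac_apply' _ measurableSet_Ioc, Set.indicator_of_mem h]
      simp
    · simp only [Measure.smul_apply, Measure.dirac_apply' _ measurableSet_Ioc, smul_eq_mul]
      rw [Set.indicator_of_notMem h, Set.indicator_of_notMem (by exact h), mul_zero]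
  have hF : {j | x j ∈ Set.Ioc A B}.Finite := hset ▸ hfin.subset Set.sdiff_subset
  rw [h1, ← tsum_subtype, ENNReal.tsum_const, ENat.card_coe_set_eq, ← hF.cast_ncard_eq, hset,
    Set.ncard_sdiff hA (hfin.subset hA)]
  have hle := Set.ncard_le_ncard hA hfin
  unfold NFun countingFunction
  rw [← mul_sub, ENNReal.ofReal_mul (by norm_num), ← Nat.cast_sub hle, ENNReal.ofReal_natCast,
    mul_comm]
  simp

/-- The integral of `1` against `dR` over `(A, B]` is the increment of `R`. -/
theorem integralDR_one (x : ℕ → ℝ) {A B : ℝ} (hAB : A ≤ B) (hfin : {j | x j ≤ B}.Finite) :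
    integralDR x (fun _ ↦ 1) A B = RFun x B - RFun x A := by
  have hle : NFun x A ≤ NFun x B := by
    have := Set.ncard_le_ncard (fun j (hj : x j ≤ A) ↦ hj.trans hAB :
      {j | x j ≤ A} ⊆ {j | x j ≤ B}) hfin
    unfold NFun countingFunction
    have h2 : (({j | x j ≤ A}.ncard : ℕ) : ℝ) ≤ ({j | x j ≤ B}.ncard : ℕ) := by exact_mod_cast this
    linarith
  simp only [integralDR, RFun, integral_const, intervalIntegral.integral_const, Measure.real,
    Measure.restrict_apply MeasurableSet.univ, Set.univ_inter, dN_Ioc x hAB hfin,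
    ENNReal.toReal_ofReal (sub_nonneg.2 hle), smul_eq_mul]
  ring

theorem improperIntegralDR_eq {x : ℕ → ℝ} {f : ℝ → ℝ} {a : ℝ} (h : HasImproperIntegralDR x f a) :
    improperIntegralDR x f = a := by
  have hex : ∃ a, HasImproperIntegralDR x f a := ⟨a, h⟩
  rw [improperIntegralDR, dif_pos hex]
  exact tendsto_nhds_unique hex.choose_spec h

end

/-! Write p = 1/2 + 2η for the exponent 2c. Cut the half-line at 1, 2, 3, … and freeze V^(-p) at the
left end of each cell (k+1, k+2]. The integral becomes the series ∑ (k+1)^(-p) (2 K_k - 1), where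
the K_k are the independent Poisson(1/2) counts of the cells. It converges almost surely because p >
1/2 makes the weights square-summable. The freezing error is at most ∑ (k+1)^(-3/2) (2 K_k + 1) plus
the contribution of (0, 1], a finite random bound that is uniform for p away from 1
(`exists_tendsto_primitiveDR`). This gives the convergence of the integral, and the factor √(2η)
removes the error as η → 0.

There remains the series. A linear combination with coefficients t is ∑ w_k (2 K_k - 1), with w_k
given by `unitWeight`. Its characteristic function is exp ∑ ψ(w_k), where ψ(w) = (e^(2iw) - 1)/2 -
iw = -w² + O(|w|³). Since sup |w_k| → 0, only ∑ w_k² matters. With u_j = 2η_j this equals ∑ t_a t_b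
√(u_a u_b) ζ(1 + u_a + u_b). The pole of ζ at 1 makes the factor of t_a t_b behave like √(u_a
u_b)/(u_a + u_b), which is 1/2 for a = b and tends to 0 for a ≠ b because the rates are separated
(`tendsto_tsum_unitWeight_sq`). Hence the limit is exp(-|t|²/2), and Lévy's continuity theorem
concludes. -/

/-! ### Almost sure convergence of series of independent variables. -/

section Probability

variable {Ω : Type*} [MeasurableSpace Ω] {P : Measure Ω}

/-- A series of independent centred square-integrable measurable random variables with summable
variances converges almost surely. -/
theorem ae_tendsto_sum_of_iIndepFun_of_stronglyMeasurable [IsProbabilityMeasure P]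
    {X : ℕ → Ω → ℝ} (hm : ∀ n, StronglyMeasurable (X n)) (hX : iIndepFun X P)
    (hL : ∀ n, MemLp (X n) 2 P) (h0 : ∀ n, P[X n] = 0)
    (hV : Summable fun n ↦ variance (X n) P) :
    ∀ᵐ ω ∂P, ∃ c, Tendsto (fun n ↦ ∑ k ∈ Finset.range n, X k ω) atTop (𝓝 c) := by
  have hi (n : ℕ) : Integrable (X n) P := (hL n).integrable (by norm_num)
  -- The sum runs up to index n inclusive, so that `S n` is adapted to the natural filtration at
  -- time n.
  let S : ℕ → Ω → ℝ := fun n ↦ ∑ k ∈ Finset.range (n + 1), X k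
  have hS2 (n : ℕ) : MemLp (S n) 2 P := memLp_finsetSum' _ fun k _ ↦ hL k
  have hS : Martingale S (Filtration.natural X hm) P := by
    refine martingale_of_condExp_sub_eq_zero_nat (fun n ↦ ?_) (fun n ↦ ?_) fun n ↦ ?_
    · refine Finset.stronglyMeasurable_sum _ fun k hk ↦ ?_
      exact (Filtration.stronglyAdapted_natural hm k).mono
        (Filtration.mono _ (Nat.lt_succ_iff.1 (Finset.mem_range.1 hk)))
    · exact (hS2 n).integrable (by norm_num)
    · have h : S (n + 1) - S n = X (n + 1) := by
        simp [S, Finset.sum_range_succ _ (n + 1)]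
      rw [h]
      refine (hX.condExp_natural_ae_eq_of_lt hm n.lt_succ_self).trans ?_
      simp only [h0]
      rfl
  have hvar (n : ℕ) : variance (S n) P ≤ ∑' k, variance (X k) P := by
    rw [IndepFun.variance_sum (fun k _ ↦ hL k) fun i _ j _ hij ↦ hX.indepFun hij]
    exact hV.sum_le_tsum _ fun k _ ↦ variance_nonneg _ _
  -- The variance bound gives a uniform L² bound, hence the uniform L¹ bound that martingale
  -- convergence requires.
  have hb (n : ℕ) : eLpNorm (S n) 1 P ≤ (Real.toNNReal (√(∑' k, variance (X k) P)) : ℝ≥0) := by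
    refine (eLpNorm_le_eLpNorm_of_exponent_le (q := 2) (by norm_num)
      (hS2 n).aestronglyMeasurable).trans ?_
    have hmean : P[S n] = 0 := by
      simp only [S, Finset.sum_apply]
      rw [integral_finsetSum _ fun k _ ↦ hi k]
      simp [h0]
    have h2 : variance (S n) P = ∫ ω, S n ω ^ 2 ∂P :=
      variance_of_integral_eq_zero (hS2 n).aestronglyMeasurable.aemeasurable hmean
    rw [(hS2 n).eLpNorm_eq_integral_rpow_norm (by norm_num) (by norm_num),
      ENNReal.ofReal]
    refine ENNReal.coe_le_coe.2 (Real.toNNReal_le_toNNReal ?_)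
    have h3 : ∫ ω, ‖S n ω‖ ^ (2 : ℝ≥0∞).toReal ∂P = variance (S n) P := by
      rw [h2]
      simp
    rw [h3, Real.sqrt_eq_rpow]
    have h4 := Real.rpow_le_rpow (z := 1 / 2) (variance_nonneg (S n) P) (hvar n) (by norm_num)
    simpa using h4
  filter_upwards [hS.submartingale.exists_ae_tendsto_of_bdd hb] with ω ⟨c, hc⟩
  refine ⟨c, (tendsto_add_atTop_iff_nat 1).1 ?_⟩
  simpa [S] using hc

/-- A series of independent centred square-integrable random variables with summable variances
converges almost surely. -/
theorem ae_tendsto_sum_of_iIndepFun [IsProbabilityMeasure P]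
    {X : ℕ → Ω → ℝ} (hX : iIndepFun X P)
    (hL : ∀ n, MemLp (X n) 2 P) (h0 : ∀ n, P[X n] = 0)
    (hV : Summable fun n ↦ variance (X n) P) :
    ∀ᵐ ω ∂P, ∃ c, Tendsto (fun n ↦ ∑ k ∈ Finset.range n, X k ω) atTop (𝓝 c) := by
  have hae (n : ℕ) : X n =ᵐ[P] (hL n).1.mk := (hL n).1.ae_eq_mk
  have h := ae_tendsto_sum_of_iIndepFun_of_stronglyMeasurable (X := fun n ↦ (hL n).1.mk)
    (fun n ↦ (hL n).1.stronglyMeasurable_mk) (hX.congr hae) (fun n ↦ (hL n).ae_eq (hae n))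
    (fun n ↦ by rw [← h0 n]; exact integral_congr_ae (hae n).symm)
    (by simpa only [variance_congr (hae _)] using hV)
  filter_upwards [h, ae_all_iff.2 hae] with ω hω hω'
  simpa only [hω'] using hω

/-! ### Poisson moments and weighted series of Poisson variables. -/

theorem summable_poisson_weight_mul_sq (r : ℝ≥0) :
    Summable fun n : ℕ ↦ Real.exp (-r) * (r : ℝ) ^ n / (n.factorial : ℝ) * (n : ℝ) ^ 2 := by
  have h := ((Real.summable_pow_div_factorial (Real.exp 1 * r)).mul_left 2).mul_left
    (Real.exp (-r))
  refine h.of_nonneg_of_le (fun n ↦ by positivity) fun n ↦ ?_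
  have h2 : (n : ℝ) ^ 2 ≤ 2 * Real.exp 1 ^ n := by
    have := Real.quadratic_le_exp_of_nonneg (x := n) (by positivity)
    rw [← Real.exp_nat_mul, mul_one]
    nlinarith [(Nat.cast_nonneg n : (0 : ℝ) ≤ n)]
  calc Real.exp (-r) * (r : ℝ) ^ n / (n.factorial : ℝ) * (n : ℝ) ^ 2
      ≤ Real.exp (-r) * (r : ℝ) ^ n / (n.factorial : ℝ) * (2 * Real.exp 1 ^ n) := by gcongr
    _ = _ := by rw [mul_pow]; ring

theorem memLp_natCast_poissonMeasure (r : ℝ≥0) :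
    MemLp (fun n : ℕ ↦ (n : ℝ)) 2 (poissonMeasure r) := by
  rw [memLp_two_iff_integrable_sq .of_discrete, integrable_poissonMeasure_iff]
  simpa using summable_poisson_weight_mul_sq r

theorem integral_natCast_poissonMeasure (r : ℝ≥0) :
    ∫ n, (n : ℝ) ∂poissonMeasure r = r := by
  rw [integral_poissonMeasure, tsum_eq_zero_add']
  · have h (n : ℕ) : (Real.exp (-r) * (r : ℝ) ^ (n + 1) / ((n + 1).factorial : ℝ)) •
        ((n + 1 : ℕ) : ℝ) = r * (Real.exp (-r) * (r : ℝ) ^ n / (n.factorial : ℝ)) := by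
      rw [Nat.factorial_succ]
      have : (n.factorial : ℝ) ≠ 0 := by positivity
      push_cast
      simp only [smul_eq_mul]
      field_simp
      ring
    simp_rw [h]
    rw [tsum_mul_left, (hasSum_one_poissonMeasure r).tsum_eq]
    simp
  · have h := (hasSum_integral_poissonMeasure
      ((memLp_natCast_poissonMeasure r).integrable (by norm_num))).summable
    exact (summable_nat_add_iff 1).2 h

variable {K : ℕ → Ω → ℕ}

theorem memLp_natCast_of_hasLaw {r : ℝ≥0} {K : Ω → ℕ} (hK : HasLaw K (poissonMeasure r) P) :
    MemLp (fun ω ↦ (K ω : ℝ)) 2 P := by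
  have := memLp_natCast_poissonMeasure r
  rw [← hK.map_eq] at this
  exact this.comp_of_map hK.aemeasurable

theorem integral_natCast_of_hasLaw {r : ℝ≥0} {K : Ω → ℕ} (hK : HasLaw K (poissonMeasure r) P) :
    ∫ ω, (K ω : ℝ) ∂P = r := by
  rw [← integral_natCast_poissonMeasure r, ← hK.map_eq, integral_map hK.aemeasurable .of_discrete]

/-- A weighted series of independent compensated Poisson variables with square-summable weights
converges almost surely. -/
theorem ae_tendsto_sum_mul_poisson [IsProbabilityMeasure P] (hind : iIndepFun K P)
    (hK : ∀ n, HasLaw (K n) (poissonMeasure (1 / 2)) P) {a : ℕ → ℝ}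
    (ha : Summable fun n ↦ a n ^ 2) :
    ∀ᵐ ω ∂P, ∃ c, Tendsto (fun n ↦ ∑ k ∈ Finset.range n, a k * (2 * K k ω - 1)) atTop (𝓝 c) := by
  have hL (n : ℕ) : MemLp (fun ω ↦ 2 * (K n ω : ℝ) - 1) 2 P :=
    ((memLp_natCast_of_hasLaw (hK n)).const_mul 2).sub (memLp_const 1)
  refine ae_tendsto_sum_of_iIndepFun (X := fun n ω ↦ a n * (2 * K n ω - 1)) ?_
    (fun n ↦ (hL n).const_mul (a n)) (fun n ↦ ?_) ?_
  · exact hind.comp (fun n k ↦ a n * (2 * (k : ℝ) - 1)) fun n ↦ .of_discrete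
  · rw [integral_const_mul, integral_sub (((memLp_natCast_of_hasLaw (hK n)).integrable
      (by norm_num)).const_mul 2) (integrable_const 1), integral_const_mul,
      integral_natCast_of_hasLaw (hK n)]
    simp
  · have hv (n : ℕ) : variance (fun ω ↦ a n * (2 * (K n ω : ℝ) - 1)) P =
        variance (fun k : ℕ ↦ 2 * (k : ℝ) - 1) (poissonMeasure (1 / 2)) * a n ^ 2 := by
      rw [variance_const_mul, ← (hK n).map_eq, variance_map .of_discrete (hK n).aemeasurable,
        mul_comm]
      rfl
    simp_rw [hv]
    exact ha.mul_left _

/-- By Tonelli the expectation of ∑ b_k K_k is finite. With b_k = (k+1)^(-3/2) this makes the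
freezing error finite almost surely. -/
theorem ae_summable_mul_poisson [IsProbabilityMeasure P]
    (hK : ∀ n, HasLaw (K n) (poissonMeasure (1 / 2)) P) {b : ℕ → ℝ}
    (hb0 : ∀ n, 0 ≤ b n) (hb : Summable b) :
    ∀ᵐ ω ∂P, Summable fun k ↦ b k * (2 * K k ω + 1) := by
  have hE (k : ℕ) : ∫⁻ ω, ENNReal.ofReal (b k * K k ω) ∂P = ENNReal.ofReal (b k * (1 / 2)) := by
    rw [← ofReal_integral_eq_lintegral_ofReal, integral_const_mul,
      integral_natCast_of_hasLaw (hK k)]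
    · simp
    · exact ((memLp_natCast_of_hasLaw (hK k)).integrable (by norm_num)).const_mul _
    · exact ae_of_all _ fun ω ↦ mul_nonneg (hb0 k) (Nat.cast_nonneg _)
  have hm (k : ℕ) : AEMeasurable (fun ω ↦ ENNReal.ofReal (b k * K k ω)) P :=
    (Measurable.of_discrete (f := fun n : ℕ ↦ ENNReal.ofReal (b k * n))).comp_aemeasurable
      (hK k).aemeasurable
  have hfin : ∫⁻ ω, ∑' k, ENNReal.ofReal (b k * K k ω) ∂P ≠ ∞ := by
    rw [lintegral_tsum hm]
    simp_rw [hE]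
    exact (hb.mul_right _).tsum_ofReal_ne_top
  filter_upwards [ae_lt_top' (AEMeasurable.tsum hm) hfin] with ω hω
  have h1 : Summable fun k ↦ b k * (K k ω : ℝ) := by
    have := ENNReal.summable_toReal hω.ne
    refine this.congr fun k ↦ ?_
    rw [ENNReal.toReal_ofReal (mul_nonneg (hb0 k) (Nat.cast_nonneg _))]
  refine ((h1.mul_left 2).add hb).congr fun k ↦ ?_
  ring

/-! ### Characteristic functions of compensated Poisson series. -/

/-- The exponent in the characteristic function of twice a compensated Poisson variable with
parameter `1/2`. -/
noncomputable def compensatedExponent (a : ℝ) : ℂ :=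
  (Complex.exp (2 * a * Complex.I) - 1) / 2 - a * Complex.I

theorem integral_cexp_poisson [IsProbabilityMeasure P] {K : Ω → ℕ}
    (hK : HasLaw K (poissonMeasure (1 / 2)) P) (a : ℝ) :
    ∫ ω, Complex.exp ((a * (2 * K ω - 1) : ℝ) * Complex.I) ∂P =
      Complex.exp (compensatedExponent a) := by
  have h := charFun_map_cast_poissonMeasure (1 / 2) (2 * a)
  rw [charFun_apply_real, integral_map .of_discrete (by fun_prop), ← hK.map_eq,
    integral_map hK.aemeasurable .of_discrete] at h
  have h2 (ω : Ω) : Complex.exp ((a * (2 * K ω - 1) : ℝ) * Complex.I) =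
      Complex.exp (-(a * Complex.I)) *
        Complex.exp (((2 * a : ℝ) : ℂ) * (K ω : ℝ) * Complex.I) := by
    rw [← Complex.exp_add]
    congr 1
    push_cast
    ring
  simp_rw [h2]
  rw [integral_const_mul, h, ← Complex.exp_add, compensatedExponent]
  congr 1
  push_cast
  ring

theorem integral_cexp_sum_poisson [IsProbabilityMeasure P] (hind : iIndepFun K P)
    (hK : ∀ n, HasLaw (K n) (poissonMeasure (1 / 2)) P) (a : ℕ → ℝ) (n : ℕ) :
    ∫ ω, Complex.exp ((∑ k ∈ Finset.range n, a k * (2 * K k ω - 1) : ℝ) * Complex.I) ∂P =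
      Complex.exp (∑ k ∈ Finset.range n, compensatedExponent (a k)) := by
  have hm (k : ℕ) : AEMeasurable (fun ω ↦ a k * (2 * (K k ω : ℝ) - 1)) P :=
    (Measurable.of_discrete (f := fun n : ℕ ↦ a k * (2 * (n : ℝ) - 1))).comp_aemeasurable
      (hK k).aemeasurable
  have hi : iIndepFun (fun k ω ↦ a k * (2 * (K k ω : ℝ) - 1)) P :=
    hind.comp (fun n k ↦ a n * (2 * (k : ℝ) - 1)) fun n ↦ .of_discrete
  have h := congrFun (iIndepFun.charFun_map_fun_finsetSum_eq_prod (s := Finset.range n)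
    (fun k _ ↦ hm k) (hi.restrict _)) 1
  rw [charFun_apply_real, integral_map (Finset.aemeasurable_fun_sum _ fun k _ ↦ hm k)
    (by fun_prop), Finset.prod_apply] at h
  rw [Complex.exp_sum]
  convert h using 2
  · simp
  · rename_i k _
    rw [charFun_apply_real, integral_map (hm k) (by fun_prop), ← integral_cexp_poisson (hK k)]
    simp

/-- The characteristic function of a convergent weighted series of independent compensated Poisson
variables. -/
theorem integral_cexp_of_tendsto_sum_poisson [IsProbabilityMeasure P] (hind : iIndepFun K P)
    (hK : ∀ n, HasLaw (K n) (poissonMeasure (1 / 2)) P) {a : ℕ → ℝ}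
    (ha : Summable fun k ↦ compensatedExponent (a k)) {S : Ω → ℝ}
    (hS : ∀ᵐ ω ∂P,
      Tendsto (fun n ↦ ∑ k ∈ Finset.range n, a k * (2 * K k ω - 1)) atTop (𝓝 (S ω))) :
    ∫ ω, Complex.exp (S ω * Complex.I) ∂P = Complex.exp (∑' k, compensatedExponent (a k)) := by
  have hm (k : ℕ) : AEMeasurable (fun ω ↦ a k * (2 * (K k ω : ℝ) - 1)) P :=
    (Measurable.of_discrete (f := fun n : ℕ ↦ a k * (2 * (n : ℝ) - 1))).comp_aemeasurable
      (hK k).aemeasurable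
  have h1 : Tendsto (fun n ↦ ∫ ω, Complex.exp
      ((∑ k ∈ Finset.range n, a k * (2 * K k ω - 1) : ℝ) * Complex.I) ∂P) atTop
      (𝓝 (∫ ω, Complex.exp (S ω * Complex.I) ∂P)) := by
    refine tendsto_integral_of_dominated_convergence (fun _ ↦ 1) (fun n ↦ ?_)
      (integrable_const _) (fun n ↦ ae_of_all _ fun ω ↦ ?_) ?_
    · have := Finset.aemeasurable_fun_sum (Finset.range n) fun k _ ↦ hm k
      exact AEMeasurable.aestronglyMeasurable (by fun_prop)
    · rw [Complex.norm_exp_ofReal_mul_I]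
    · filter_upwards [hS] with ω hω
      have hc : Continuous fun x : ℝ ↦ Complex.exp (x * Complex.I) := by fun_prop
      exact (hc.tendsto _).comp hω
  refine tendsto_nhds_unique h1 ?_
  simp_rw [integral_cexp_sum_poisson hind hK]
  exact (Complex.continuous_exp.tendsto _).comp ha.hasSum.tendsto_sum_nat

end Probability

/-! ### Pathwise comparison of the improper integral with the series of unit counts. -/

section Deterministic

variable {x : ℕ → ℝ}

/-- Indices start at 0 and the points increase to infinity, so the indices of the points up to V
form an initial segment whose length is the count. This turns integrals against `dN` into sums over
index intervals. -/
theorem lt_countingFunction_iff (hx : StrictMono x) (htop : Tendsto x atTop atTop) {V : ℝ} {j : ℕ} :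
    j < countingFunction x V ↔ x j ≤ V := by
  classical
  have hex : ∃ n, V < x n := (htop.eventually_gt_atTop V).exists
  have hset : {j | x j ≤ V} = Set.Iio (Nat.find hex) := by
    ext j
    rw [Set.mem_ofPred_eq, Set.mem_Iio, Nat.lt_find_iff]
    exact ⟨fun h m hm ↦ not_lt.2 ((hx.monotone hm).trans h), fun h ↦ not_lt.1 (h j le_rfl)⟩
  have h : countingFunction x V = Nat.find hex := by
    rw [countingFunction, hset, ← Finset.coe_Iio, Set.ncard_coe_finset, Nat.card_Iio]
  rw [h, ← Set.mem_Iio, ← hset, Set.mem_ofPred_eq]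

theorem countingFunction_mono (hx : StrictMono x) (htop : Tendsto x atTop atTop) :
    Monotone (countingFunction x) := by
  intro A B hAB
  by_contra! h
  have h1 := (lt_countingFunction_iff hx htop).1 h
  exact lt_irrefl _ ((lt_countingFunction_iff hx htop).2 (h1.trans hAB))

theorem countingFunction_apply (hx : StrictMono x) (htop : Tendsto x atTop atTop) (n : ℕ) :
    countingFunction x (x n) = n + 1 := by
  refine le_antisymm ?_ ((lt_countingFunction_iff hx htop).2 le_rfl)
  by_contra! h
  exact absurd ((lt_countingFunction_iff hx htop).1 h) (not_le.2 (hx n.lt_succ_self))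

theorem integral_dN_Ioc (hx : StrictMono x) (htop : Tendsto x atTop atTop) (f : ℝ → ℝ)
    (A B : ℝ) :
    ∫ V in Set.Ioc A B, f V ∂(dN x) =
      ∑ j ∈ Finset.Ico (countingFunction x A) (countingFunction x B), 2 * f (x j) := by
  rw [← integral_indicator measurableSet_Ioc, dN,
    integral_sum_dirac (c := fun _ ↦ (2 : ℝ≥0∞)) (by simp),
    tsum_eq_sum (s := Finset.Ico (countingFunction x A) (countingFunction x B))]
  · refine Finset.sum_congr rfl fun j hj ↦ ?_
    rw [Finset.mem_Ico, lt_countingFunction_iff hx htop, ← not_lt,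
      lt_countingFunction_iff hx htop, not_le] at hj
    rw [Set.indicator_of_mem (show x j ∈ Set.Ioc A B from hj)]
    simp
  · intro j hj
    rw [Finset.mem_Ico, lt_countingFunction_iff hx htop, ← not_lt,
      lt_countingFunction_iff hx htop, not_le] at hj
    rw [Set.indicator_of_notMem (show x j ∉ Set.Ioc A B from hj), smul_zero]

/-- The primitive of `V ^ (-p)` with respect to `dR` that vanishes at `0`. -/
noncomputable def primitiveDR (x : ℕ → ℝ) (p B : ℝ) : ℝ :=
  ∑ j ∈ Finset.range (countingFunction x B), 2 * x j ^ (-p) - B ^ (1 - p) / (1 - p)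

theorem integralDR_rpow (hx : StrictMono x) (htop : Tendsto x atTop atTop) {p : ℝ} (hp : p < 1)
    {A B : ℝ} (hAB : A ≤ B) :
    integralDR x (fun V ↦ V ^ (-p)) A B = primitiveDR x p B - primitiveDR x p A := by
  rw [integralDR, integral_dN_Ioc hx htop,
    Finset.sum_Ico_eq_sub _ (countingFunction_mono hx htop hAB),
    integral_rpow (Or.inl (by linarith)), primitiveDR, primitiveDR, neg_add_eq_sub]
  ring

theorem tendsto_primitiveDR_zero (hpos : ∀ j, 0 < x j) (hx : StrictMono x)
    (htop : Tendsto x atTop atTop) {p : ℝ} (hp : p < 1) :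
    Tendsto (primitiveDR x p) (𝓝[>] 0) (𝓝 0) := by
  have h1 : Tendsto (fun B : ℝ ↦ -(B ^ (1 - p) / (1 - p))) (𝓝 0) (𝓝 0) := by
    have h := ((Real.continuousAt_rpow_const 0 (1 - p)
      (Or.inr (by linarith))).tendsto.div_const (1 - p)).neg
    simpa [Real.zero_rpow (by linarith : 1 - p ≠ 0)] using h
  refine (h1.mono_left nhdsWithin_le_nhds).congr' ?_
  filter_upwards [nhdsWithin_le_nhds (Iio_mem_nhds (hpos 0))] with B hB
  have h0 : countingFunction x B = 0 := by
    by_contra h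
    exact absurd ((lt_countingFunction_iff hx htop).1 (Nat.pos_of_ne_zero h)) (not_le.2 hB)
  simp [primitiveDR, h0]

theorem hasImproperIntegralDR_rpow (hpos : ∀ j, 0 < x j) (hx : StrictMono x)
    (htop : Tendsto x atTop atTop) {p : ℝ} (hp : p < 1) {H : ℝ}
    (hH : Tendsto (primitiveDR x p) atTop (𝓝 H)) :
    HasImproperIntegralDR x (fun V ↦ V ^ (-p)) H := by
  have h := (hH.comp tendsto_snd).sub
    ((tendsto_primitiveDR_zero hpos hx htop hp).comp (tendsto_fst (f := 𝓝[>] (0 : ℝ))))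
  rw [sub_zero] at h
  refine h.congr' ?_
  have h1 : ∀ᶠ q : ℝ × ℝ in 𝓝[>] 0 ×ˢ atTop, q.1 < 1 :=
    tendsto_fst.eventually (nhdsWithin_le_nhds (Iio_mem_nhds one_pos))
  have h2 : ∀ᶠ q : ℝ × ℝ in 𝓝[>] 0 ×ˢ atTop, 1 ≤ q.2 :=
    tendsto_snd.eventually (eventually_ge_atTop 1)
  filter_upwards [h1, h2] with q hq1 hq2
  rw [integralDR_rpow hx htop hp (hq1.le.trans hq2)]
  rfl

/-- The number of points in `(k + 1, k + 2]`. -/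
noncomputable def unitCount (x : ℕ → ℝ) (k : ℕ) : ℕ :=
  countingFunction x (k + 2) - countingFunction x (k + 1)

theorem primitiveDR_sub (hx : StrictMono x) (htop : Tendsto x atTop atTop) {p A B : ℝ}
    (hAB : A ≤ B) :
    primitiveDR x p B - primitiveDR x p A =
      ∑ j ∈ Finset.Ico (countingFunction x A) (countingFunction x B), 2 * x j ^ (-p) -
        (B ^ (1 - p) - A ^ (1 - p)) / (1 - p) := by
  rw [Finset.sum_Ico_eq_sub _ (countingFunction_mono hx htop hAB), primitiveDR, primitiveDR]
  ring

theorem rpow_primitive_sub_bounds {p A B : ℝ} (h0 : 0 ≤ p) (hp : p < 1) (hA : 0 < A)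
    (hAB : A ≤ B) :
    (B - A) * B ^ (-p) ≤ (B ^ (1 - p) - A ^ (1 - p)) / (1 - p) ∧
      (B ^ (1 - p) - A ^ (1 - p)) / (1 - p) ≤ (B - A) * A ^ (-p) := by
  have hi : ∫ V in A..B, V ^ (-p) = (B ^ (1 - p) - A ^ (1 - p)) / (1 - p) := by
    rw [integral_rpow (Or.inl (by linarith)), neg_add_eq_sub]
  have hint : IntervalIntegrable (fun V : ℝ ↦ V ^ (-p)) volume A B :=
    intervalIntegral.intervalIntegrable_rpow' (by linarith)
  rw [← hi]
  constructor
  · have h := intervalIntegral.integral_mono_on hAB (intervalIntegrable_const (c := B ^ (-p))) hint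
      fun V hV ↦ Real.rpow_le_rpow_of_nonpos (hA.trans_le hV.1) hV.2 (by linarith)
    simpa using h
  · have h := intervalIntegral.integral_mono_on hAB hint (intervalIntegrable_const (c := A ^ (-p)))
      fun V hV ↦ Real.rpow_le_rpow_of_nonpos hA hV.1 (by linarith)
    simpa using h

/-- Controls the primitive inside a cell, so that convergence along the integers extends to real B.
The point sum and the Lebesgue part are both nonnegative and bounded by their mass times the value
at the left end. -/
theorem abs_primitiveDR_sub_le (hx : StrictMono x) (htop : Tendsto x atTop atTop) {p : ℝ}
    (h0 : 0 ≤ p) (hp : p < 1) (k : ℕ) {B : ℝ} (h1 : (k : ℝ) + 1 ≤ B) (h2 : B ≤ k + 2) :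
    |primitiveDR x p B - primitiveDR x p (k + 1)| ≤
      ((k : ℝ) + 1) ^ (-p) * (2 * unitCount x k + 1) := by
  have hk : (0 : ℝ) < k + 1 := by positivity
  obtain ⟨hb1, hb2⟩ := rpow_primitive_sub_bounds h0 hp hk h1
  rw [primitiveDR_sub hx htop h1]
  have hB : (0 : ℝ) < B := hk.trans_le h1
  have hnn : 0 ≤ (B - (k + 1)) * B ^ (-p) := by
    have := Real.rpow_nonneg hB.le (-p)
    exact mul_nonneg (by linarith) this
  have hle : (B - (k + 1)) * ((k : ℝ) + 1) ^ (-p) ≤ 1 * ((k : ℝ) + 1) ^ (-p) := by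
    gcongr
    linarith
  have hcard : ((countingFunction x B - countingFunction x (k + 1) : ℕ) : ℝ) ≤ unitCount x k := by
    rw [unitCount]
    exact_mod_cast Nat.sub_le_sub_right (countingFunction_mono hx htop h2) _
  have hs1 : ∑ j ∈ Finset.Ico (countingFunction x (k + 1)) (countingFunction x B),
      2 * x j ^ (-p) ≤ unitCount x k * (2 * ((k : ℝ) + 1) ^ (-p)) := by
    refine (Finset.sum_le_card_nsmul _ _ (2 * ((k : ℝ) + 1) ^ (-p)) fun j hj ↦ ?_).trans ?_
    · rw [Finset.mem_Ico, ← not_lt, lt_countingFunction_iff hx htop, not_le] at hj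
      have := Real.rpow_le_rpow_of_nonpos hk hj.1.le (neg_nonpos.2 h0)
      linarith
    · rw [Nat.card_Ico, nsmul_eq_mul]
      gcongr
  have hs0 : 0 ≤ ∑ j ∈ Finset.Ico (countingFunction x (k + 1)) (countingFunction x B),
      2 * x j ^ (-p) := by
    refine Finset.sum_nonneg fun j hj ↦ ?_
    rw [Finset.mem_Ico, ← not_lt, lt_countingFunction_iff hx htop, not_le] at hj
    have := Real.rpow_nonneg (hk.trans hj.1).le (-p)
    linarith
  rw [abs_le]
  have hc0 : (0 : ℝ) ≤ unitCount x k * ((k : ℝ) + 1) ^ (-p) := by positivity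
  constructor <;> linarith

/-- With r = (k+1)/(k+2), the difference is (k+1)^(-p) (1 - r^p), and r^p ≥ r because p ≤ 1. This
leaves (k+1)^(-p)/(k+2), at most (k+1)^(-1/2-1): a summable bound free of p. -/
theorem rpow_neg_sub_rpow_neg_le {p : ℝ} (hp : 1 / 2 ≤ p) (hp1 : p ≤ 1) (k : ℕ) :
    ((k : ℝ) + 1) ^ (-p) - ((k : ℝ) + 2) ^ (-p) ≤ ((k : ℝ) + 1) ^ (-(3 / 2) : ℝ) := by
  have hk : (0 : ℝ) < k + 1 := by positivity
  have hk2 : (0 : ℝ) < k + 2 := by positivity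
  have h1 : ((k : ℝ) + 2) ^ (-p) = ((k : ℝ) + 1) ^ (-p) * (((k : ℝ) + 1) / (k + 2)) ^ p := by
    rw [Real.div_rpow hk.le hk2.le, Real.rpow_neg hk.le, Real.rpow_neg hk2.le]
    have := (Real.rpow_pos_of_pos hk p).ne'
    field_simp
  have h2 : ((k : ℝ) + 1) / (k + 2) ≤ (((k : ℝ) + 1) / (k + 2)) ^ p :=
    Real.self_le_rpow_of_le_one (by positivity) ((div_le_one hk2).2 (by linarith)) hp1
  have h3 : ((k : ℝ) + 1) / (k + 2) = 1 - 1 / (k + 2) := by field_simp; ring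
  have h4 : 1 / ((k : ℝ) + 2) ≤ ((k : ℝ) + 1) ^ (-1 : ℝ) := by
    rw [Real.rpow_neg_one, one_div]
    gcongr
    linarith
  have h5 : ((k : ℝ) + 1) ^ (-p) ≤ ((k : ℝ) + 1) ^ (-(1 / 2) : ℝ) :=
    Real.rpow_le_rpow_of_exponent_le (by linarith [(Nat.cast_nonneg k : (0 : ℝ) ≤ k)])
      (by linarith)
  have h6 : 0 < ((k : ℝ) + 1) ^ (-p) := Real.rpow_pos_of_pos hk _
  calc ((k : ℝ) + 1) ^ (-p) - ((k : ℝ) + 2) ^ (-p)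
      = ((k : ℝ) + 1) ^ (-p) * (1 - (((k : ℝ) + 1) / (k + 2)) ^ p) := by rw [h1]; ring
    _ ≤ ((k : ℝ) + 1) ^ (-p) * ((k : ℝ) + 1) ^ (-1 : ℝ) := by
        gcongr
        linarith
    _ ≤ ((k : ℝ) + 1) ^ (-(1 / 2) : ℝ) * ((k : ℝ) + 1) ^ (-1 : ℝ) := by gcongr
    _ = _ := by rw [← Real.rpow_add hk]; norm_num

/-- On a cell V^(-p) lies between its end values. The point sum, of mass 2K, and the Lebesgue
integral, of mass 1, therefore each differ from their frozen versions by at most their mass times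
the oscillation. -/
theorem abs_primitiveDR_succ_sub_le (hx : StrictMono x) (htop : Tendsto x atTop atTop) {p : ℝ}
    (h0 : 1 / 2 ≤ p) (hp : p < 1) (k : ℕ) :
    |primitiveDR x p (k + 2) - primitiveDR x p (k + 1) -
        ((k : ℝ) + 1) ^ (-p) * (2 * unitCount x k - 1)| ≤
      ((k : ℝ) + 1) ^ (-(3 / 2) : ℝ) * (2 * unitCount x k + 1) := by
  have hk : (0 : ℝ) < k + 1 := by positivity
  have h12 : (k : ℝ) + 1 ≤ k + 2 := by linarith
  obtain ⟨hb1, hb2⟩ := rpow_primitive_sub_bounds (by linarith) hp hk h12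
  rw [primitiveDR_sub hx htop h12]
  have hd := rpow_neg_sub_rpow_neg_le h0 hp.le k
  have hcard : ((Finset.Ico (countingFunction x (k + 1)) (countingFunction x (k + 2))).card : ℝ) =
      unitCount x k := by
    rw [Nat.card_Ico, unitCount]
  have hs1 : ∑ j ∈ Finset.Ico (countingFunction x (k + 1)) (countingFunction x (k + 2)),
      2 * x j ^ (-p) ≤ unitCount x k * (2 * ((k : ℝ) + 1) ^ (-p)) := by
    rw [← hcard, ← nsmul_eq_mul]
    refine Finset.sum_le_card_nsmul _ _ _ fun j hj ↦ ?_
    rw [Finset.mem_Ico, ← not_lt, lt_countingFunction_iff hx htop, not_le] at hj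
    have := Real.rpow_le_rpow_of_nonpos hk hj.1.le (by linarith : -p ≤ 0)
    linarith
  have hs0 : unitCount x k * (2 * ((k : ℝ) + 2) ^ (-p)) ≤
      ∑ j ∈ Finset.Ico (countingFunction x (k + 1)) (countingFunction x (k + 2)),
        2 * x j ^ (-p) := by
    rw [← hcard, ← nsmul_eq_mul]
    refine Finset.card_nsmul_le_sum _ _ _ fun j hj ↦ ?_
    rw [Finset.mem_Ico, ← not_lt, lt_countingFunction_iff hx htop, not_le,
      lt_countingFunction_iff hx htop] at hj
    have := Real.rpow_le_rpow_of_nonpos (hk.trans hj.1) hj.2 (by linarith : -p ≤ 0)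
    linarith
  have hU : (0 : ℝ) ≤ unitCount x k := by positivity
  have hm := mul_le_mul_of_nonneg_left hd hU
  have he : (k : ℝ) + 2 - (k + 1) = 1 := by ring
  rw [he, one_mul] at hb1 hb2
  rw [abs_le]
  constructor <;> nlinarith

/-- If the compensated unit counts, weighted by `(k + 1) ^ (-p)`, have a convergent series with sum
`D`, then the primitive converges at infinity to a limit within a distance of `D` that is bounded
uniformly for `p` away from `1`. -/
theorem exists_tendsto_primitiveDR (hpos : ∀ j, 0 < x j) (hx : StrictMono x)
    (htop : Tendsto x atTop atTop) {p : ℝ} (h0 : 1 / 2 ≤ p) (hp : p < 1)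
    (hsum : Summable fun k : ℕ ↦ ((k : ℝ) + 1) ^ (-(3 / 2) : ℝ) * (2 * unitCount x k + 1)) {D : ℝ}
    (hD : Tendsto (fun n ↦ ∑ k ∈ Finset.range n, ((k : ℝ) + 1) ^ (-p) * (2 * unitCount x k - 1))
      atTop (𝓝 D)) :
    ∃ H, Tendsto (primitiveDR x p) atTop (𝓝 H) ∧
      |H - D| ≤ ∑ j ∈ Finset.range (countingFunction x 1), 2 * (x j)⁻¹ + 1 / (1 - p) +
        ∑' k : ℕ, ((k : ℝ) + 1) ^ (-(3 / 2) : ℝ) * (2 * unitCount x k + 1) := by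
  let e : ℕ → ℝ := fun k ↦ primitiveDR x p (k + 2) - primitiveDR x p (k + 1) -
    ((k : ℝ) + 1) ^ (-p) * (2 * unitCount x k - 1)
  have he (k : ℕ) : ‖e k‖ ≤ ((k : ℝ) + 1) ^ (-(3 / 2) : ℝ) * (2 * unitCount x k + 1) :=
    abs_primitiveDR_succ_sub_le hx htop h0 hp k
  have hes : Summable e := hsum.of_norm_bounded he
  -- Telescoping from 1: every increment is a frozen term plus its error `e k`.
  let H : ℝ := primitiveDR x p 1 + (D + ∑' k, e k)
  have hnat : Tendsto (fun n : ℕ ↦ primitiveDR x p (n + 1)) atTop (𝓝 H) := by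
    have h := (hD.add hes.hasSum.tendsto_sum_nat).const_add (primitiveDR x p 1)
    refine h.congr fun n ↦ ?_
    rw [← Finset.sum_add_distrib]
    induction n with
    | zero => simp
    | succ n ih =>
      rw [Finset.sum_range_succ, ← add_assoc, ih]
      simp only [e]
      push_cast
      ring_nf
  -- The terms of the convergent series tend to 0, and adding 2 (k+1)^(-p) → 0 turns 2K - 1 into 2K
  -- + 1.
  have hgap : Tendsto (fun k : ℕ ↦ ((k : ℝ) + 1) ^ (-p) * (2 * unitCount x k + 1)) atTop (𝓝 0) := by
    have h1 : Tendsto (fun k : ℕ ↦ ((k : ℝ) + 1) ^ (-p) * (2 * (unitCount x k : ℝ) - 1))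
        atTop (𝓝 0) := by
      have h := (hD.comp (tendsto_add_atTop_nat 1)).sub hD
      rw [sub_self] at h
      refine h.congr fun n ↦ ?_
      simp [Finset.sum_range_succ]
    have h2 : Tendsto (fun k : ℕ ↦ ((k : ℝ) + 1) ^ (-p)) atTop (𝓝 0) :=
      (tendsto_rpow_neg_atTop (by linarith)).comp
        (tendsto_atTop_add_const_right _ _ tendsto_natCast_atTop_atTop)
    have h := h1.add (h2.const_mul 2)
    rw [mul_zero, add_zero] at h
    exact h.congr fun k ↦ by ring
  refine ⟨H, ?_, ?_⟩
  -- The index of the cell containing B; the cells start at 1, hence the shift.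
  · let n : ℝ → ℕ := fun B ↦ ⌊B - 1⌋₊
    have hn : Tendsto n atTop atTop :=
      tendsto_nat_floor_atTop.comp (tendsto_atTop_add_const_right _ (-1) tendsto_id)
    have hz : Tendsto (fun B ↦ primitiveDR x p B - primitiveDR x p (n B + 1)) atTop (𝓝 0) := by
      refine squeeze_zero_norm' ?_ (hgap.comp hn)
      filter_upwards [eventually_ge_atTop 1] with B hB
      refine abs_primitiveDR_sub_le hx htop (by linarith) hp _ ?_ ?_
      · linarith [Nat.floor_le (sub_nonneg.2 hB)]
      · linarith [Nat.lt_floor_add_one (B - 1)]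
    have h := hz.add (hnat.comp hn)
    rw [zero_add] at h
    refine h.congr fun B ↦ ?_
    simp
  · have h1 : |∑' k, e k| ≤
        ∑' k : ℕ, ((k : ℝ) + 1) ^ (-(3 / 2) : ℝ) * (2 * unitCount x k + 1) :=
      tsum_of_norm_bounded hsum.hasSum he
    have h2 : |primitiveDR x p 1| ≤
        ∑ j ∈ Finset.range (countingFunction x 1), 2 * (x j)⁻¹ + 1 / (1 - p) := by
      have hp1 : 0 < 1 - p := by linarith
      rw [primitiveDR, Real.one_rpow]
      refine (abs_sub _ _).trans (add_le_add ?_ (abs_of_pos (by positivity)).le)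
      rw [abs_of_nonneg (Finset.sum_nonneg fun j _ ↦
        mul_nonneg two_pos.le (Real.rpow_nonneg (hpos j).le _))]
      refine Finset.sum_le_sum fun j hj ↦ ?_
      rw [Finset.mem_range, lt_countingFunction_iff hx htop] at hj
      -- The points counted here are at most 1, so passing to exponent -1 gives a bound free of p.
      have : x j ^ (-p) ≤ x j ^ (-1 : ℝ) :=
        Real.rpow_le_rpow_of_exponent_ge (hpos j) hj (by linarith)
      rw [Real.rpow_neg_one] at this
      linarith
    have h3 : H - D = primitiveDR x p 1 + ∑' k, e k := by simp only [H]; ring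
    rw [h3]
    exact (abs_add_le _ _).trans (add_le_add h2 h1)

end Deterministic

/-! ### Expansion of the exponent and asymptotics of the sum of squared weights. -/

section Asymptotics

/-- Taylor's bound of order three at 2ai, available since |2a| ≤ 1; its constant 8/9 is rounded up
to 1. The quadratic term is -a² because 2K - 1 has variance 2. -/
theorem norm_compensatedExponent_add_sq_le {a : ℝ} (ha : |a| ≤ 1 / 2) :
    ‖compensatedExponent a + (a : ℂ) ^ 2‖ ≤ |a| ^ 3 := by
  have hz : ‖(2 * a * Complex.I : ℂ)‖ = 2 * |a| := by simp
  have h := Complex.exp_bound (x := 2 * a * Complex.I) (by rw [hz]; linarith) (n := 3) (by norm_num)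
  have he : compensatedExponent a + (a : ℂ) ^ 2 = (Complex.exp (2 * a * Complex.I) -
      ∑ m ∈ Finset.range 3, (2 * a * Complex.I) ^ m / (m.factorial : ℂ)) / 2 := by
    simp only [compensatedExponent, Finset.sum_range_succ, Finset.sum_range_zero, mul_pow,
      Complex.I_sq]
    norm_num [Nat.factorial]
    ring
  rw [hz] at h
  rw [he, norm_div, Complex.norm_ofNat]
  norm_num [Nat.factorial, mul_pow] at h ⊢
  have : 0 ≤ |a| ^ 3 := by positivity
  linarith

theorem summable_compensatedExponent {a : ℕ → ℝ} (ha : Summable fun k ↦ a k ^ 2)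
    (hb : ∀ k, |a k| ≤ 1 / 2) : Summable fun k ↦ compensatedExponent (a k) := by
  have h1 : Summable fun k ↦ compensatedExponent (a k) + (a k : ℂ) ^ 2 := by
    refine ha.of_norm_bounded fun k ↦ (norm_compensatedExponent_add_sq_le (hb k)).trans ?_
    rw [← sq_abs]
    nlinarith [hb k, sq_nonneg |a k|]
  have h2 : Summable fun k ↦ (a k : ℂ) ^ 2 := by exact_mod_cast Complex.summable_ofReal.2 ha
  simpa using h1.sub h2

/-- A Lyapunov-type argument: the total cubic error is at most δ ∑ a_k², which vanishes when the
weights are uniformly small. -/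
theorem tendsto_tsum_compensatedExponent {ι : Type*} {l : Filter ι} {a : ι → ℕ → ℝ} {δ : ι → ℝ}
    {v : ℝ} (ha : ∀ i, Summable fun k ↦ a i k ^ 2)
    (hv : Tendsto (fun i ↦ ∑' k, a i k ^ 2) l (𝓝 v)) (hδ : Tendsto δ l (𝓝 0))
    (hb : ∀ i k, |a i k| ≤ δ i) :
    Tendsto (fun i ↦ ∑' k, compensatedExponent (a i k)) l (𝓝 (-v : ℂ)) := by
  have hsq (i : ι) : HasSum (fun k ↦ (a i k : ℂ) ^ 2) ((∑' k, a i k ^ 2 : ℝ) : ℂ) := by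
    exact_mod_cast Complex.hasSum_ofReal.2 (ha i).hasSum
  have hz : Tendsto (fun i ↦ ∑' k, compensatedExponent (a i k) + ((∑' k, a i k ^ 2 : ℝ) : ℂ)) l
      (𝓝 0) := by
    refine squeeze_zero_norm' ?_ (by simpa using hδ.mul hv)
    filter_upwards [hδ.eventually_le_const (by norm_num : (0 : ℝ) < 1 / 2)] with i hi
    have hb' (k : ℕ) : |a i k| ≤ 1 / 2 := (hb i k).trans hi
    rw [← ((summable_compensatedExponent (ha i) hb').hasSum.add (hsq i)).tsum_eq]
    refine tsum_of_norm_bounded ((ha i).hasSum.mul_left (δ i)) fun k ↦ ?_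
    refine (norm_compensatedExponent_add_sq_le (hb' k)).trans ?_
    rw [← sq_abs (a i k), pow_succ' |a i k| 2]
    exact mul_le_mul_of_nonneg_right (hb i k) (sq_nonneg _)
  have h := hz.sub ((Complex.continuous_ofReal.tendsto v).comp hv)
  rw [zero_sub] at h
  exact h.congr fun i ↦ by simp

theorem hasSum_rpow_neg {s : ℝ} (hs : 1 < s) :
    HasSum (fun k : ℕ ↦ ((k : ℝ) + 1) ^ (-s)) (∑' n : ℕ, 1 / (n : ℝ) ^ s) := by
  have h := (Real.summable_one_div_nat_rpow.2 hs).hasSum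
  -- The dropped term n = 0 is 1 / 0 ^ s, which is 0 since division by zero gives 0.
  rw [← hasSum_nat_add_iff' 1] at h
  simp only [Finset.range_one, Finset.sum_singleton, Nat.cast_zero,
    Real.zero_rpow (by linarith : s ≠ 0), div_zero, sub_zero] at h
  refine h.congr_fun fun k ↦ ?_
  rw [Real.rpow_neg (by positivity)]
  simp

/-- Of two parameters of different order of smallness, the geometric mean is negligible against the
sum. -/
theorem tendsto_sqrt_mul_sqrt_div_add {ι : Type*} {l : Filter ι} {u v : ι → ℝ}
    (hu : ∀ i, 0 < u i) (hv : ∀ i, 0 < v i) (h : Tendsto (fun i ↦ u i / v i) l (𝓝 0)) :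
    Tendsto (fun i ↦ √(u i) * √(v i) / (u i + v i)) l (𝓝 0) := by
  have hs : Tendsto (fun i ↦ √(u i / v i)) l (𝓝 0) := by
    have h' := (Real.continuous_sqrt.tendsto 0).comp h
    rwa [Real.sqrt_zero] at h'
  refine squeeze_zero (fun i ↦ ?_) (fun i ↦ ?_) hs
  · have := hu i
    have := hv i
    positivity
  · have h1 := hu i
    have h2 := hv i
    rw [Real.sqrt_div h1.le, div_le_div_iff₀ (by positivity) (by positivity), mul_assoc,
      Real.mul_self_sqrt h2.le]
    gcongr
    linarith

variable {ι : Type*} {l : Filter ι} {m : ℕ} {η : ι → Fin m → ℝ}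

theorem tendsto_ratio_of_lt (hpos : ∀ i j, 0 < η i j)
    (hη : ∀ (j : ℕ) (hj : j + 1 < m),
      Tendsto (fun i ↦ η i ⟨j, Nat.lt_of_succ_lt hj⟩ / η i ⟨j + 1, hj⟩) l (𝓝 0))
    {j k : ℕ} (hk : k < m) (hjk : j < k) :
    Tendsto (fun i ↦ η i ⟨j, hjk.trans hk⟩ / η i ⟨k, hk⟩) l (𝓝 0) := by
  induction k, hjk using Nat.le_induction with
  | base => exact hη j hk
  | succ k hjk ih =>
    have h := (ih (Nat.lt_of_succ_lt hk)).mul (hη k hk)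
    rw [mul_zero] at h
    exact h.congr fun i ↦ div_mul_div_cancel₀ (hpos i _).ne'

/-- The normalized weight of the `k`-th unit interval in the linear combination with
coefficients `t`. -/
noncomputable def unitWeight (η t : Fin m → ℝ) (k : ℕ) : ℝ :=
  ∑ j, t j * (√(2 * η j) * ((k : ℝ) + 1) ^ (-(1 / 2 + 2 * η j)))

theorem hasSum_unitWeight_sq {η : Fin m → ℝ} (hη : ∀ j, 0 < η j) (t : Fin m → ℝ) :
    HasSum (fun k ↦ unitWeight η t k ^ 2)
      (∑ a, ∑ b, t a * t b * (√(2 * η a) * √(2 * η b) *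
        ∑' n : ℕ, 1 / (n : ℝ) ^ (1 + (2 * η a + 2 * η b)))) := by
  have h := hasSum_sum (s := Finset.univ) fun a _ ↦ hasSum_sum (s := Finset.univ) fun b _ ↦
    ((hasSum_rpow_neg (s := 1 + (2 * η a + 2 * η b)) (by linarith [hη a, hη b])).mul_left
      (√(2 * η a) * √(2 * η b))).mul_left (t a * t b)
  refine h.congr_fun fun k ↦ ?_
  rw [unitWeight, sq, Finset.sum_mul_sum]
  refine Finset.sum_congr rfl fun a _ ↦ Finset.sum_congr rfl fun b _ ↦ ?_
  rw [show -(1 + (2 * η a + 2 * η b)) = -(1 / 2 + 2 * η a) + -(1 / 2 + 2 * η b) by ring,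
    Real.rpow_add (by positivity)]
  ring

theorem abs_unitWeight_le {η : Fin m → ℝ} (hη : ∀ j, 0 < η j) (t : Fin m → ℝ) (k : ℕ) :
    |unitWeight η t k| ≤ ∑ j, |t j| * √(2 * η j) := by
  refine (Finset.abs_sum_le_sum_abs _ _).trans (Finset.sum_le_sum fun j _ ↦ ?_)
  have h1 : ((k : ℝ) + 1) ^ (-(1 / 2 + 2 * η j)) ≤ 1 :=
    Real.rpow_le_one_of_one_le_of_nonpos (by linarith [(Nat.cast_nonneg k : (0 : ℝ) ≤ k)])
      (by linarith [hη j])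
  have h0 : 0 ≤ ((k : ℝ) + 1) ^ (-(1 / 2 + 2 * η j)) := by positivity
  rw [abs_mul, abs_mul, abs_of_nonneg h0, abs_of_nonneg (Real.sqrt_nonneg _)]
  gcongr
  exact mul_le_of_le_one_right (Real.sqrt_nonneg _) h1

/-- With u = 2η_a and v = 2η_b, each entry is √u √v/(u + v) times (u + v) ζ(1 + u + v). The second
factor tends to 1, the residue of ζ at 1. The first is 1/2 on the diagonal and vanishes in the limit
off it, where one of u/v and v/u tends to 0. -/
theorem tendsto_tsum_unitWeight_sq (hpos : ∀ i j, 0 < η i j) (h0 : Tendsto η l (𝓝 0))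
    (hη : ∀ (j : ℕ) (hj : j + 1 < m),
      Tendsto (fun i ↦ η i ⟨j, Nat.lt_of_succ_lt hj⟩ / η i ⟨j + 1, hj⟩) l (𝓝 0))
    (t : Fin m → ℝ) :
    Tendsto (fun i ↦ ∑' k, unitWeight (η i) t k ^ 2) l (𝓝 ((∑ j, t j ^ 2) / 2)) := by
  have hj (j : Fin m) : Tendsto (fun i ↦ η i j) l (𝓝 0) := tendsto_pi_nhds.1 h0 j
  have hlim : (∑ j, t j ^ 2) / 2 =
      ∑ a, ∑ b, t a * t b * ((if a = b then 1 / 2 else 0) * 1) := by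
    simp [Finset.sum_mul, sq, div_eq_mul_inv]
  simp_rw [fun i ↦ (hasSum_unitWeight_sq (hpos i) t).tsum_eq, hlim]
  refine tendsto_finsetSum _ fun a _ ↦ tendsto_finsetSum _ fun b _ ↦ Tendsto.const_mul _ ?_
  have hu (i : ι) (j : Fin m) : 0 < 2 * η i j := by linarith [hpos i j]
  have hz : Tendsto (fun i ↦ (2 * η i a + 2 * η i b) *
      ∑' n : ℕ, 1 / (n : ℝ) ^ (1 + (2 * η i a + 2 * η i b))) l (𝓝 1) := by
    have hs : Tendsto (fun i ↦ 1 + (2 * η i a + 2 * η i b)) l (𝓝[>] 1) := by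
      refine tendsto_nhdsWithin_iff.2 ⟨?_, Eventually.of_forall fun i ↦ ?_⟩
      · simpa using (((hj a).const_mul 2).add ((hj b).const_mul 2)).const_add 1
      · exact lt_add_of_pos_right _ (add_pos (hu i a) (hu i b))
    refine (tendsto_sub_mul_tsum_nat_rpow.comp hs).congr fun i ↦ ?_
    simp
  have hr : Tendsto (fun i ↦ √(2 * η i a) * √(2 * η i b) / (2 * η i a + 2 * η i b)) l
      (𝓝 (if a = b then 1 / 2 else 0)) := by
    have hdiv (a b : Fin m) (hab : a < b) :
        Tendsto (fun i ↦ 2 * η i a / (2 * η i b)) l (𝓝 0) := by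
      refine (tendsto_ratio_of_lt hpos hη b.2 hab).congr fun i ↦ ?_
      rw [mul_div_mul_left _ _ two_ne_zero]
    rcases lt_trichotomy a b with hab | rfl | hab
    · rw [if_neg hab.ne]
      exact tendsto_sqrt_mul_sqrt_div_add (hu · a) (hu · b) (hdiv a b hab)
    · rw [if_pos rfl]
      refine tendsto_const_nhds.congr fun i ↦ ?_
      rw [Real.mul_self_sqrt (hu i a).le]
      have := (hpos i a).ne'
      field_simp
      norm_num
    · rw [if_neg hab.ne']
      refine (tendsto_sqrt_mul_sqrt_div_add (hu · b) (hu · a) (hdiv b a hab)).congr fun i ↦ ?_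
      rw [mul_comm, add_comm]
  refine (hr.mul hz).congr fun i ↦ ?_
  rw [← mul_assoc, div_mul_cancel₀ _ (add_pos (hu i a) (hu i b)).ne']

theorem tendsto_tsum_compensatedExponent_unitWeight (hpos : ∀ i j, 0 < η i j)
    (h0 : Tendsto η l (𝓝 0))
    (hη : ∀ (j : ℕ) (hj : j + 1 < m),
      Tendsto (fun i ↦ η i ⟨j, Nat.lt_of_succ_lt hj⟩ / η i ⟨j + 1, hj⟩) l (𝓝 0))
    (t : Fin m → ℝ) :
    Tendsto (fun i ↦ ∑ j, |t j| * √(2 * η i j)) l (𝓝 0) ∧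
    Tendsto (fun i ↦ ∑' k, compensatedExponent (unitWeight (η i) t k)) l
      (𝓝 (-((∑ j, t j ^ 2) / 2 : ℝ) : ℂ)) := by
  have hδ : Tendsto (fun i ↦ ∑ j, |t j| * √(2 * η i j)) l (𝓝 0) := by
    have hj (j : Fin m) : Tendsto (fun i ↦ |t j| * √(2 * η i j)) l (𝓝 0) := by
      have hc : Continuous fun y : ℝ ↦ |t j| * √(2 * y) := by fun_prop
      have h := (hc.tendsto 0).comp (tendsto_pi_nhds.1 h0 j)
      rwa [mul_zero, Real.sqrt_zero, mul_zero] at h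
    simpa using tendsto_finsetSum Finset.univ fun j _ ↦ hj j
  exact ⟨hδ, tendsto_tsum_compensatedExponent
    (fun i ↦ (hasSum_unitWeight_sq (hpos i) t).summable)
    (tendsto_tsum_unitWeight_sq hpos h0 hη t) hδ fun i k ↦ abs_unitWeight_le (hpos i) t k⟩

end Asymptotics

/-! ### Application to the Poisson process and convergence in distribution. -/

section PoissonProcess

variable {Ω : Type*} [MeasurableSpace Ω] {P : Measure Ω} {T : Ω → ℕ → ℝ}

theorem IsPoissonProcess.iIndepFun_unitCount (hT : IsPoissonProcess T (1 / 2) P) :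
    iIndepFun (fun k ω ↦ unitCount (T ω) k) P := by
  have h := hT.indep.nat (t := fun k : ℕ ↦ (k : ℝ≥0) + 1) fun a b hab ↦ by
    simpa using hab
  convert h using 4 with k ω
  push_cast
  rw [unitCount, add_assoc, one_add_one_eq_two]

theorem IsPoissonProcess.hasLaw_unitCount (hT : IsPoissonProcess T (1 / 2) P) (k : ℕ) :
    HasLaw (fun ω ↦ unitCount (T ω) k) (poissonMeasure (1 / 2)) P := by
  have h := hT.law (k + 1) (k + 2) (by gcongr; norm_num)
  have h1 : ((k : ℝ≥0) + 2) - (k + 1) = 1 := by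
    rw [← one_add_one_eq_two, ← add_assoc, add_tsub_cancel_left]
  rw [h1, mul_one] at h
  simpa [unitCount] using h

/-- A bound for the difference between the integral and its discretization that does not depend on
the exponent. -/
noncomputable def discretizationBound (x : ℕ → ℝ) : ℝ :=
  ∑ j ∈ Finset.range (countingFunction x 1), 2 * (x j)⁻¹ +
    ∑' k : ℕ, ((k : ℝ) + 1) ^ (-(3 / 2) : ℝ) * (2 * unitCount x k + 1)

/-- The limit of the compensated unit counts weighted by the powers of exponent
`-(1 / 2 + 2 * η)`. -/
noncomputable def discretizedHVar (x : ℕ → ℝ) (η : ℝ) : ℝ :=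
  limUnder atTop fun n ↦ ∑ k ∈ Finset.range n,
    ((k : ℝ) + 1) ^ (-(1 / 2 + 2 * η)) * (2 * unitCount x k - 1)

theorem IsPoissonProcess.ae_HVar [IsProbabilityMeasure P] (hT : IsPoissonProcess T (1 / 2) P)
    {η : ℝ} (hη : η ∈ Set.Ioo (0 : ℝ) (1 / 4)) :
    ∀ᵐ ω ∂P,
      HasImproperIntegralDR (T ω) (fun V ↦ V ^ (-2 * (1 / 4 + η))) (HVar (T ω) (1 / 4 + η)) ∧
      Tendsto (primitiveDR (T ω) (1 / 2 + 2 * η)) atTop (𝓝 (HVar (T ω) (1 / 4 + η))) ∧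
      Tendsto (fun n ↦ ∑ k ∈ Finset.range n,
        ((k : ℝ) + 1) ^ (-(1 / 2 + 2 * η)) * (2 * unitCount (T ω) k - 1)) atTop
        (𝓝 (discretizedHVar (T ω) η)) ∧
      |HVar (T ω) (1 / 4 + η) - discretizedHVar (T ω) η| ≤
        discretizationBound (T ω) + 1 / (1 / 2 - 2 * η) := by
  obtain ⟨h0, h1⟩ := hη
  have hsq : Summable fun k : ℕ ↦ (((k : ℝ) + 1) ^ (-(1 / 2 + 2 * η))) ^ 2 := by
    refine (hasSum_rpow_neg (s := 1 + 4 * η) (by linarith)).summable.congr fun k ↦ ?_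
    rw [← Real.rpow_natCast, ← Real.rpow_mul (by positivity)]
    congr 1
    push_cast
    ring
  filter_upwards [hT.pos, hT.strictMono, hT.tendsto_atTop,
    ae_tendsto_sum_mul_poisson hT.iIndepFun_unitCount hT.hasLaw_unitCount hsq,
    ae_summable_mul_poisson hT.hasLaw_unitCount (fun k ↦ by positivity)
      (hasSum_rpow_neg (s := 3 / 2) (by norm_num)).summable] with ω hpos hmono htop ⟨D, hD⟩ hsum
  have hp : 1 / 2 + 2 * η < 1 := by linarith
  obtain ⟨H, hH, hHD⟩ :=
    exists_tendsto_primitiveDR hpos hmono htop (by linarith) hp hsum hD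
  have himp := hasImproperIntegralDR_rpow hpos hmono htop hp hH
  rw [show -(1 / 2 + 2 * η) = -2 * (1 / 4 + η) by ring] at himp
  have hHV : HVar (T ω) (1 / 4 + η) = H := improperIntegralDR_eq himp
  have hDV : discretizedHVar (T ω) η = D := hD.limUnder_eq
  rw [hHV, hDV]
  refine ⟨himp, hH, hD, hHD.trans (le_of_eq ?_)⟩
  rw [discretizationBound, show 1 - (1 / 2 + 2 * η) = 1 / 2 - 2 * η by ring]
  ring

/-- `HVar` is defined by choice, so measurability comes from writing it as an almost sure limit of
the primitive at the points themselves. At `T ω n` the count is n + 1, which makes the sum a fixed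
finite one. -/
theorem IsPoissonProcess.aemeasurable_HVar [IsProbabilityMeasure P]
    (hT : IsPoissonProcess T (1 / 2) P) {η : ℝ} (hη : η ∈ Set.Ioo (0 : ℝ) (1 / 4)) :
    AEMeasurable (fun ω ↦ HVar (T ω) (1 / 4 + η)) P := by
  have hTm (j : ℕ) : Measurable fun ω ↦ T ω j := measurable_pi_iff.1 hT.measurable j
  refine aemeasurable_of_tendsto_metrizable_ae atTop
    (f := fun n ω ↦ ∑ j ∈ Finset.range (n + 1), 2 * T ω j ^ (-(1 / 2 + 2 * η)) -
      T ω n ^ (1 - (1 / 2 + 2 * η)) / (1 - (1 / 2 + 2 * η))) (fun n ↦ ?_) ?_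
  · exact ((Finset.measurable_fun_sum _ fun j _ ↦ ((hTm j).pow_const _).const_mul 2).sub
      (((hTm n).pow_const _).div_const _)).aemeasurable
  · filter_upwards [hT.strictMono, hT.tendsto_atTop, hT.ae_HVar hη] with ω hmono htop h
    refine (h.2.1.comp htop).congr fun n ↦ ?_
    rw [Function.comp_apply, primitiveDR, countingFunction_apply hmono htop]

theorem IsPoissonProcess.aemeasurable_discretizedHVar [IsProbabilityMeasure P]
    (hT : IsPoissonProcess T (1 / 2) P) {η : ℝ} (hη : η ∈ Set.Ioo (0 : ℝ) (1 / 4)) :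
    AEMeasurable (fun ω ↦ discretizedHVar (T ω) η) P := by
  refine aemeasurable_of_tendsto_metrizable_ae atTop (fun n ↦ ?_)
    ((hT.ae_HVar hη).mono fun ω h ↦ h.2.2.1)
  refine Finset.aemeasurable_fun_sum _ fun k _ ↦ ?_
  exact (Measurable.of_discrete (f := fun n : ℕ ↦
    ((k : ℝ) + 1) ^ (-(1 / 2 + 2 * η)) * (2 * (n : ℝ) - 1))).comp_aemeasurable
      (hT.hasLaw_unitCount k).aemeasurable

variable {m : ℕ}

theorem IsPoissonProcess.integral_cexp_discretizedHVar [IsProbabilityMeasure P]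
    (hT : IsPoissonProcess T (1 / 2) P) {η : Fin m → ℝ} (hη : ∀ j, η j ∈ Set.Ioo (0 : ℝ) (1 / 4))
    (t : Fin m → ℝ) (hs : Summable fun k ↦ compensatedExponent (unitWeight η t k)) :
    ∫ ω, Complex.exp ((∑ j, t j * (√(2 * η j) * discretizedHVar (T ω) (η j)) : ℝ) * Complex.I) ∂P =
      Complex.exp (∑' k, compensatedExponent (unitWeight η t k)) := by
  refine integral_cexp_of_tendsto_sum_poisson hT.iIndepFun_unitCount hT.hasLaw_unitCount hs ?_
  filter_upwards [ae_all_iff.2 fun j ↦ hT.ae_HVar (hη j)] with ω hω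
  have h := tendsto_finsetSum Finset.univ fun j _ ↦
    (((hω j).2.2.1.const_mul (√(2 * η j))).const_mul (t j))
  refine h.congr fun n ↦ ?_
  simp_rw [unitWeight, Finset.sum_mul, Finset.mul_sum]
  rw [Finset.sum_comm]
  refine Finset.sum_congr rfl fun k _ ↦ Finset.sum_congr rfl fun j _ ↦ ?_
  ring

variable {ι : Type*} {l : Filter ι} {η : ι → Fin m → ℝ}

/-- For fixed ω the freezing error stays bounded as η → 0, and √(2η) sends it to 0. Countability of
the index set provides one event of full measure for all parameters. -/
theorem IsPoissonProcess.ae_tendsto_sum_HVar_sub [IsProbabilityMeasure P] [Countable ι]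
    (hT : IsPoissonProcess T (1 / 2) P) (hη : ∀ i j, η i j ∈ Set.Ioo (0 : ℝ) (1 / 4))
    (h0 : Tendsto η l (𝓝 0)) (t : Fin m → ℝ) :
    ∀ᵐ ω ∂P, Tendsto (fun i ↦ ∑ j, t j * (√(2 * η i j) * HVar (T ω) (1 / 4 + η i j)) -
      ∑ j, t j * (√(2 * η i j) * discretizedHVar (T ω) (η i j))) l (𝓝 0) := by
  filter_upwards [ae_all_iff.2 fun i ↦ ae_all_iff.2 fun j ↦ hT.ae_HVar (hη i j)] with ω hω
  simp_rw [← Finset.sum_sub_distrib, ← mul_sub]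
  have hj (j : Fin m) : Tendsto (fun i ↦ t j * (√(2 * η i j) *
      (HVar (T ω) (1 / 4 + η i j) - discretizedHVar (T ω) (η i j)))) l (𝓝 0) := by
    have hηj : Tendsto (fun i ↦ η i j) l (𝓝 0) := tendsto_pi_nhds.1 h0 j
    have hs : Tendsto (fun i ↦ √(2 * η i j)) l (𝓝 0) := by
      have hc : Continuous fun y : ℝ ↦ √(2 * y) := by fun_prop
      have h := (hc.tendsto 0).comp hηj
      rwa [mul_zero, Real.sqrt_zero] at h
    have hb : Tendsto (fun i ↦ discretizationBound (T ω) + 1 / (1 / 2 - 2 * η i j)) l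
        (𝓝 (discretizationBound (T ω) + 1 / (1 / 2 - 2 * 0))) :=
      ((tendsto_const_nhds (x := (1 : ℝ))).div ((hηj.const_mul 2).const_sub (1 / 2))
        (by norm_num)).const_add _
    have hz : Tendsto (fun i ↦ √(2 * η i j) *
        (HVar (T ω) (1 / 4 + η i j) - discretizedHVar (T ω) (η i j))) l (𝓝 0) := by
      refine squeeze_zero_norm (fun i ↦ ?_) (by simpa only [zero_mul] using hs.mul hb)
      rw [norm_mul, Real.norm_of_nonneg (Real.sqrt_nonneg _)]
      exact mul_le_mul_of_nonneg_left (hω i j).2.2.2 (Real.sqrt_nonneg _)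
    simpa using hz.const_mul (t j)
  simpa using tendsto_finsetSum Finset.univ fun j _ ↦ hj j

/-- Passing to the discretized variables changes the integrand by a quantity bounded by 2 that tends
to 0 almost surely. Dominated convergence then transfers the limit known for the discretization. -/
theorem IsPoissonProcess.tendsto_integral_cexp_HVar [IsProbabilityMeasure P] [Countable ι]
    [l.IsCountablyGenerated]
    (hT : IsPoissonProcess T (1 / 2) P) (hη : ∀ i j, η i j ∈ Set.Ioo (0 : ℝ) (1 / 4))
    (h0 : Tendsto η l (𝓝 0))
    (hratio : ∀ (j : ℕ) (hj : j + 1 < m),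
      Tendsto (fun i ↦ η i ⟨j, Nat.lt_of_succ_lt hj⟩ / η i ⟨j + 1, hj⟩) l (𝓝 0))
    (t : Fin m → ℝ) :
    Tendsto (fun i ↦ ∫ ω, Complex.exp
      ((∑ j, t j * (√(2 * η i j) * HVar (T ω) (1 / 4 + η i j)) : ℝ) * Complex.I) ∂P) l
      (𝓝 (Complex.exp (-((∑ j, t j ^ 2) / 2 : ℝ)))) := by
  let A : ι → Ω → ℝ := fun i ω ↦ ∑ j, t j * (√(2 * η i j) * HVar (T ω) (1 / 4 + η i j))
  let D : ι → Ω → ℝ := fun i ω ↦ ∑ j, t j * (√(2 * η i j) * discretizedHVar (T ω) (η i j))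
  have hA (i : ι) : AEMeasurable (A i) P := Finset.aemeasurable_fun_sum _ fun j _ ↦
    ((hT.aemeasurable_HVar (hη i j)).const_mul _).const_mul _
  have hD (i : ι) : AEMeasurable (D i) P := Finset.aemeasurable_fun_sum _ fun j _ ↦
    ((hT.aemeasurable_discretizedHVar (hη i j)).const_mul _).const_mul _
  have hm {f : Ω → ℝ} (hf : AEMeasurable f P) :
      AEStronglyMeasurable (fun ω ↦ Complex.exp (f ω * Complex.I)) P :=
    AEMeasurable.aestronglyMeasurable (by fun_prop)
  have hint {f : Ω → ℝ} (hf : AEMeasurable f P) :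
      Integrable (fun ω ↦ Complex.exp (f ω * Complex.I)) P :=
    (integrable_const (1 : ℝ)).mono' (hm hf)
      (ae_of_all _ fun ω ↦ by rw [Complex.norm_exp_ofReal_mul_I])
  have hlimD : Tendsto (fun i ↦ ∫ ω, Complex.exp (D i ω * Complex.I) ∂P) l
      (𝓝 (Complex.exp (-((∑ j, t j ^ 2) / 2 : ℝ)))) := by
    have hpos (i : ι) (j : Fin m) : 0 < η i j := (hη i j).1
    obtain ⟨hδ, hψ⟩ := tendsto_tsum_compensatedExponent_unitWeight hpos h0 hratio t
    refine ((Complex.continuous_exp.tendsto _).comp hψ).congr' ?_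
    filter_upwards [hδ.eventually_le_const (by norm_num : (0 : ℝ) < 1 / 2)] with i hi
    exact (hT.integral_cexp_discretizedHVar (hη i) t (summable_compensatedExponent
      (hasSum_unitWeight_sq (hpos i) t).summable
      fun k ↦ (abs_unitWeight_le (hpos i) t k).trans hi)).symm
  have hdiff : Tendsto (fun i ↦ ∫ ω, (Complex.exp (A i ω * Complex.I) -
      Complex.exp (D i ω * Complex.I)) ∂P) l (𝓝 (∫ _, 0 ∂P)) := by
    refine tendsto_integral_filter_of_dominated_convergence (fun _ ↦ 2)
      (Eventually.of_forall fun i ↦ (hm (hA i)).sub (hm (hD i)))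
      (Eventually.of_forall fun i ↦ ae_of_all _ fun ω ↦ ?_) (integrable_const _) ?_
    · refine (norm_sub_le _ _).trans ?_
      rw [Complex.norm_exp_ofReal_mul_I, Complex.norm_exp_ofReal_mul_I]
      norm_num
    · filter_upwards [hT.ae_tendsto_sum_HVar_sub hη h0 t] with ω hω
      have hc : Continuous fun y : ℝ ↦ ‖Complex.exp (y * Complex.I) - 1‖ := by fun_prop
      have h := (hc.tendsto 0).comp hω
      simp only [Complex.ofReal_zero, zero_mul, Complex.exp_zero, sub_self, norm_zero] at h
      refine squeeze_zero_norm (fun i ↦ le_of_eq ?_) h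
      have he : Complex.exp (A i ω * Complex.I) - Complex.exp (D i ω * Complex.I) =
          Complex.exp (D i ω * Complex.I) *
            (Complex.exp ((A i ω - D i ω : ℝ) * Complex.I) - 1) := by
        rw [mul_sub, ← Complex.exp_add]
        push_cast
        ring_nf
      rw [he, norm_mul, Complex.norm_exp_ofReal_mul_I, one_mul]
      rfl
  have h := hdiff.add hlimD
  rw [integral_zero, zero_add] at h
  refine h.congr fun i ↦ ?_
  rw [integral_sub (hint (hA i)) (hint (hD i)), sub_add_cancel]

/-- The vector of normalized integrals. -/
noncomputable def normalizedVector (T : Ω → ℕ → ℝ) (η : Fin m → ℝ) (ω : Ω) : Fin m → ℝ :=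
  fun j ↦ √(2 * (1 / 4 + η j) - 1 / 2) * HVar (T ω) (1 / 4 + η j)

theorem IsPoissonProcess.aemeasurable_normalizedVector [IsProbabilityMeasure P]
    (hT : IsPoissonProcess T (1 / 2) P) {η : Fin m → ℝ}
    (hη : ∀ j, η j ∈ Set.Ioo (0 : ℝ) (1 / 4)) : AEMeasurable (normalizedVector T η) P :=
  aemeasurable_pi_lambda _ fun j ↦ (hT.aemeasurable_HVar (hη j)).const_mul _

/-- Convergence in distribution along a sequence of parameters. -/
theorem IsPoissonProcess.tendstoInDistribution_normalizedVector_of_seq [IsProbabilityMeasure P]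
    (hT : IsPoissonProcess T (1 / 2) P) {η : ℕ → Fin m → ℝ}
    (hη : ∀ i j, η i j ∈ Set.Ioo (0 : ℝ) (1 / 4)) (h0 : Tendsto η atTop (𝓝 0))
    (hratio : ∀ (j : ℕ) (hj : j + 1 < m),
      Tendsto (fun i ↦ η i ⟨j, Nat.lt_of_succ_lt hj⟩ / η i ⟨j + 1, hj⟩) atTop (𝓝 0)) :
    TendstoInDistribution (fun i ↦ normalizedVector T (η i)) atTop
      (id : (Fin m → ℝ) → (Fin m → ℝ)) (fun _ ↦ P)
      (Measure.pi fun _ : Fin m ↦ gaussianReal 0 1) := by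
  have hX (i : ℕ) : AEMeasurable (normalizedVector T (η i)) P :=
    hT.aemeasurable_normalizedVector (hη i)
  -- Characteristic functions use an inner product, so Lévy's theorem is applied in `EuclideanSpace`
  -- and the result is mapped back by a continuous map.
  have hlp : Measurable (WithLp.toLp 2 : (Fin m → ℝ) → EuclideanSpace ℝ (Fin m)) := by fun_prop
  have h : TendstoInDistribution (fun i ω ↦ WithLp.toLp 2 (normalizedVector T (η i) ω)) atTop
      (WithLp.toLp 2 : (Fin m → ℝ) → EuclideanSpace ℝ (Fin m)) (fun _ ↦ P)
      (Measure.pi fun _ : Fin m ↦ gaussianReal 0 1) := by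
    refine ⟨fun i ↦ hlp.comp_aemeasurable (hX i), hlp.aemeasurable, ?_⟩
    refine ProbabilityMeasure.tendsto_iff_tendsto_charFun.2 fun t ↦ ?_
    have h1 := hT.tendsto_integral_cexp_HVar hη h0 hratio t.ofLp
    simp only [ProbabilityMeasure.coe_mk]
    rw [map_pi_eq_stdGaussian, charFun_stdGaussian]
    convert h1 using 2 with i
    · have hY : AEMeasurable (fun ω ↦ (WithLp.toLp 2 (normalizedVector T (η i) ω) :
          EuclideanSpace ℝ (Fin m))) P := hlp.comp_aemeasurable (hX i)
      rw [charFun_apply, integral_map hY (by fun_prop)]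
      refine integral_congr_ae (ae_of_all _ fun ω ↦ ?_)
      simp only [PiLp.inner_apply, normalizedVector, RCLike.inner_apply, conj_trivial]
      congr 3
      refine Finset.sum_congr rfl fun j _ ↦ ?_
      congr 3
      ring
    · congr 1
      rw [← Complex.ofReal_pow, EuclideanSpace.real_norm_sq_eq, neg_div]
      push_cast
      rfl
  exact h.continuous_comp (PiLp.continuous_ofLp 2 _)

/-! ### From sequences of parameters to arbitrary filters. -/

/-- The admissible parameters. -/
abbrev ParameterBox (m : ℕ) : Type := {η : Fin m → ℝ // ∀ j, η j ∈ Set.Ioo (0 : ℝ) (1 / 4)}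

/-- The limiting procedure in which the parameters tend to `0` at increasingly slower rates. -/
noncomputable def separatedFilter (m : ℕ) : Filter (ParameterBox m) :=
  comap Subtype.val (𝓝 0) ⊓
    ⨅ j : {j : ℕ // j + 1 < m},
      comap (fun η ↦ η.1 ⟨j.1, Nat.lt_of_succ_lt j.2⟩ / η.1 ⟨j.1 + 1, j.2⟩) (𝓝 0)

theorem tendsto_separatedFilter_iff {κ : Type*} {l : Filter κ} {η : κ → ParameterBox m} :
    Tendsto η l (separatedFilter m) ↔ Tendsto (fun i ↦ (η i).1) l (𝓝 0) ∧
      ∀ (j : ℕ) (hj : j + 1 < m),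
        Tendsto (fun i ↦ (η i).1 ⟨j, Nat.lt_of_succ_lt hj⟩ / (η i).1 ⟨j + 1, hj⟩) l (𝓝 0) := by
  simp only [separatedFilter, tendsto_inf, tendsto_iInf, tendsto_comap_iff, Subtype.forall]
  rfl

instance : (separatedFilter m).IsCountablyGenerated := by
  unfold separatedFilter
  infer_instance

/-- The law depends only on the point of the parameter box, and every admissible limiting procedure
maps into `separatedFilter`. That filter is countably generated, so convergence of the laws along it
can be tested on sequences, where the countability needed above is available. -/
theorem IsPoissonProcess.tendstoInDistribution_normalizedVector [IsProbabilityMeasure P]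
    (hT : IsPoissonProcess T (1 / 2) P) (hη : ∀ i j, η i j ∈ Set.Ioo (0 : ℝ) (1 / 4))
    (h0 : Tendsto η l (𝓝 0))
    (hratio : ∀ (j : ℕ) (hj : j + 1 < m),
      Tendsto (fun i ↦ η i ⟨j, Nat.lt_of_succ_lt hj⟩ / η i ⟨j + 1, hj⟩) l (𝓝 0)) :
    TendstoInDistribution (fun i ↦ normalizedVector T (η i)) l
      (id : (Fin m → ℝ) → (Fin m → ℝ)) (fun _ ↦ P)
      (Measure.pi fun _ : Fin m ↦ gaussianReal 0 1) := by
  let law : ParameterBox m → ProbabilityMeasure (Fin m → ℝ) := fun η ↦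
    ⟨P.map (normalizedVector T η.1),
      Measure.isProbabilityMeasure_map (hT.aemeasurable_normalizedVector η.2)⟩
  have hlaw : Tendsto law (separatedFilter m)
      (𝓝 ⟨(Measure.pi fun _ : Fin m ↦ gaussianReal 0 1).map id,
        Measure.isProbabilityMeasure_map aemeasurable_id⟩) := by
    refine tendsto_of_seq_tendsto fun u hu ↦ ?_
    obtain ⟨hu0, hur⟩ := tendsto_separatedFilter_iff.1 hu
    exact (hT.tendstoInDistribution_normalizedVector_of_seq (fun i ↦ (u i).2) hu0 hur).tendsto
  have hη' : Tendsto (fun i ↦ (⟨η i, hη i⟩ : ParameterBox m)) l (separatedFilter m) :=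
    tendsto_separatedFilter_iff.2 ⟨h0, hratio⟩
  exact ⟨fun i ↦ hT.aemeasurable_normalizedVector (hη i), aemeasurable_id, hlaw.comp hη'⟩

end PoissonProcess

theorem theorem1p6 {Ω : Type*} [MeasurableSpace Ω] (P : Measure Ω) [IsProbabilityMeasure P]
    (T : Ω → ℕ → ℝ) (hT : IsPoissonProcess T (1 / 2) P) (m : ℕ) (hm : 1 ≤ m) :
    -- each integral converges almost surely
    (∀ c ∈ Set.Ioo (1 / 4 : ℝ) (1 / 2),
      ∀ᵐ ω ∂P, HasImproperIntegralDR (T ω) (fun V ↦ V ^ (-2 * c)) (HVar (T ω) c)) ∧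
    -- convergence in distribution along an arbitrary limiting procedure `l` for the `η_j`
    ∀ {ι : Type*} (l : Filter ι) (η : ι → Fin m → ℝ),
      (∀ i j, η i j ∈ Set.Ioo (0 : ℝ) (1 / 4)) →
      Tendsto η l (𝓝 0) →
      (∀ (j : ℕ) (hj : j + 1 < m),
        Tendsto (fun i ↦ η i ⟨j, Nat.lt_of_succ_lt hj⟩ / η i ⟨j + 1, hj⟩) l (𝓝 0)) →
      TendstoInDistribution
        (fun i ω j ↦ Real.sqrt (2 * (1 / 4 + η i j) - 1 / 2) * HVar (T ω) (1 / 4 + η i j))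
        l (id : (Fin m → ℝ) → (Fin m → ℝ)) (fun _ ↦ P)
        (Measure.pi fun _ : Fin m ↦ gaussianReal 0 1) := by
  refine ⟨fun c hc ↦ ?_, fun l η hη h0 hratio ↦
    hT.tendstoInDistribution_normalizedVector hη h0 hratio⟩
  have h := hT.ae_HVar (η := c - 1 / 4) ⟨by linarith [hc.1], by linarith [hc.2]⟩
  rw [show 1 / 4 + (c - 1 / 4) = c by ring] at h
  exact h.mono fun ω hω ↦ hω.1
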